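/- Let $\lambda>0$ and let $f:\mathbb R\to\mathbb R$ satisfy * (f1) $f$ is continuous; * (f2) $f(t)=-f(-t)$ for all $t\in\mathbb R$; * (f3) $\lim_{t\to0}f(t)/t=0$; * (f4) $\lim_{t\to\infty}f(t)/t^3=1$ and $f(t)/t^3<1$ for all $t\neq0$; * (f5) $t\mapsto f(t)/t^3$ is strictly increasing on $(0,\infty)$; * (f6) $\lim_{t\to\infty}[f(t)t-4F(t)]=+\infty$, where $F(t)=\int_0^tf(\tau)\,d\tau$. Let $H^1_{rad}(\mathbb R^3)$ be the space of radial functions in the Sobolev space $H^1(\mathbb R^3)$. For $u,v\in H^1_{rad}(\mathbb R^3)$ put $\phi_u=\frac1{4\pi|\cdot|}*u^2$, $$I(u)=\frac12\int_{\mathbb R^3}(|\nabla u|^2+u^2)\,dx+\frac\lambda4\int_{\mathbb R^3}\phi_uu^2\,dx-\int_{\mathbb R^3}F(u)\,dx,$$ $$I'(u)[v]=\int_{\mathbb R^3}(\nabla u\cdot\nabla v+uv)\,dx+\lambda\int_{\mathbb R^3}\phi_uuv\,dx-\int_{\mathbb R^3}f(u)v\,dx,$$ and let $u^+=\max\{u,0\}$,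 $u^-=\min\{u,0\}$. Let $$\mathcal N=\{u\in H^1_{rad}(\mathbb R^3)\setminus\{0\}: I'(u)[u]=0\},\qquad \mathcal M=\{u\in\mathcal N: I'(u)[u^+]=0,\ u^+\not\equiv0,\ u^-\not\equiv0\}$$ be the Nehari set and the nodal Nehari set. Then $$c:=\inf_{u\in\mathcal M}I(u)>0,$$ where the infimum is taken in $[-\infty,+\infty]$ (it is $+\infty$ if $\mathcal M=\emptyset$). -/

import Mathlib

open MeasureTheory Filter Topology
open scoped ContDiff

noncomputable section

namespace SchrodingerPoisson

/-- Three-dimensional Euclidean space. -/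
abbrev E3 : Type := EuclideanSpace ℝ (Fin 3)

/-- `u ∈ L²(ℝ³)` has the weak gradient `g ∈ L²(ℝ³; ℝ³)`: for every smooth compactly supported `ψ`
and every `i`, `∫ u ∂ᵢψ = - ∫ gᵢ ψ`. -/
structure IsWeakGradient (u : E3 → ℝ) (g : E3 → E3) : Prop where
  memLp_fun : MemLp u 2 volume
  memLp_grad : MemLp g 2 volume
  integral_eq : ∀ ψ : E3 → ℝ, ContDiff ℝ ∞ ψ → HasCompactSupport ψ → ∀ i : Fin 3,
    ∫ x, u x * fderiv ℝ ψ x (EuclideanSpace.single i (1 : ℝ)) = - ∫ x, g x i * ψ x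

/-- `u` is (a representative of) an element of the Sobolev space `H¹(ℝ³)`. -/
def MemH1 (u : E3 → ℝ) : Prop := ∃ g : E3 → E3, IsWeakGradient u g

open Classical in
/-- The weak gradient `∇u` of `u ∈ H¹(ℝ³)`, which is unique up to a null set
(by convention `0` if `u ∉ H¹(ℝ³)`). -/
def weakGrad (u : E3 → ℝ) : E3 → E3 :=
  if h : MemH1 u then h.choose else 0

/-- `u` is radial: it is invariant, up to null sets, under all linear isometries of `ℝ³`. -/
def IsRadial (u : E3 → ℝ) : Prop :=
  ∀ R : E3 ≃ₗᵢ[ℝ] E3, (fun x => u (R x)) =ᵐ[volume] u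

/-- The (representatives of elements of the) space `H¹_rad(ℝ³)` of radial `H¹` functions. All
notions below depend on `u` only through its class modulo equality almost everywhere. -/
def H1rad : Set (E3 → ℝ) := {u | MemH1 u ∧ IsRadial u}

/-- The Poisson potential `φ_u = (1 / (4π|·|)) * u²`. -/
def potential (u : E3 → ℝ) (x : E3) : ℝ :=
  ∫ y, 1 / (4 * Real.pi * ‖x - y‖) * u y ^ 2

/-- The primitive `F(t) = ∫₀ᵗ f(τ) dτ`. -/
def primitive (f : ℝ → ℝ) (t : ℝ) : ℝ := ∫ τ in (0 : ℝ)..t, f τ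

/-- The energy functional
`I(u) = 1/2 ∫ (|∇u|² + u²) + λ/4 ∫ φ_u u² - ∫ F(u)`. -/
def energy (f : ℝ → ℝ) (lam : ℝ) (u : E3 → ℝ) : ℝ :=
  1 / 2 * (∫ x, (‖weakGrad u x‖ ^ 2 + u x ^ 2))
    + lam / 4 * (∫ x, potential u x * u x ^ 2)
    - ∫ x, primitive f (u x)

/-- The derivative of the energy functional,
`I'(u)[v] = ∫ (∇u · ∇v + u v) + λ ∫ φ_u u v - ∫ f(u) v`. -/
def dEnergy (f : ℝ → ℝ) (lam : ℝ) (u v : E3 → ℝ) : ℝ :=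
  (∫ x, (inner ℝ (weakGrad u x) (weakGrad v x) + u x * v x))
    + lam * (∫ x, potential u x * u x * v x)
    - ∫ x, f (u x) * v x

/-- `u⁺ = max {u, 0}`. -/
def posPt (u : E3 → ℝ) : E3 → ℝ := fun x => max (u x) 0

/-- `u⁻ = min {u, 0}` (so that `u = u⁺ + u⁻`). -/
def negPt (u : E3 → ℝ) : E3 → ℝ := fun x => min (u x) 0

/-- The Nehari set `𝓝 = {u ∈ H¹_rad(ℝ³) ∖ {0} : I'(u)[u] = 0}`. -/
def nehari (f : ℝ → ℝ) (lam : ℝ) : Set (E3 → ℝ) :=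
  {u | u ∈ H1rad ∧ ¬ u =ᵐ[volume] 0 ∧ dEnergy f lam u u = 0}

/-- The nodal Nehari set `𝓜 = {u ∈ 𝓝 : I'(u)[u⁺] = 0, u⁺ ≢ 0, u⁻ ≢ 0}`. -/
def nodalNehari (f : ℝ → ℝ) (lam : ℝ) : Set (E3 → ℝ) :=
  {u | u ∈ nehari f lam ∧ dEnergy f lam u (posPt u) = 0 ∧
    ¬ posPt u =ᵐ[volume] 0 ∧ ¬ negPt u =ᵐ[volume] 0}

end SchrodingerPoisson

end

/-!
The energy of a Nehari function is bounded below by a positive constant, so this holds in particular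
on the nodal Nehari set. Write `E = ∫ (|∇u|² + u²)`.

* Since `f(t)/t³` is increasing, `4F(t) ≤ f(t)t`, and `I'(u)[u] = 0` gives
  `I(u) = I(u) - I'(u)[u]/4 ≥ E/4` (`quarter_norm_sq_le_energy`).
* Since the Poisson term is nonnegative and `f(t)t ≤ t⁴`, the same identity gives `E ≤ ∫ u⁴`
  (`norm_sq_le_integral_pow_four`). With `t⁴ ≤ (t² + t⁶)/2` and the Sobolev inequality `∫ u⁶ ≤ C E³`
  this becomes `E ≤ C E³`, so that `E` cannot be small (`exists_pos_le_energy`).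

Mathlib has the Gagliardo–Nirenberg–Sobolev inequality for compactly supported `C¹` functions. It is
carried over to `H¹(ℝ³)` in `exists_eLpNorm_six_le`: it is applied to a cutoff of a mollification of
`u`, whose `L²` norms are controlled by those of `u` and `∇u`
(`IsWeakGradient.eLpNorm_fderiv_convolution_le`), and Fatou's lemma passes to the limit.
-/

noncomputable section

namespace SchrodingerPoisson

open scoped Convolution ENNReal NNReal

/-! ### The Sobolev inequality in `H¹(ℝ³)` -/

/-- **Young's inequality** for the convolution of an `L²` function with a kernel of mass one. -/
theorem eLpNorm_convolution_le {ρ w : E3 → ℝ} (hρ : Continuous ρ)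
    (hρ1 : ∫⁻ t, ‖ρ t‖ₑ = 1) (hw : AEStronglyMeasurable w volume) :
    eLpNorm (ρ ⋆[ContinuousLinearMap.lsmul ℝ ℝ, volume] w) 2 volume ≤ eLpNorm w 2 volume := by
  have hk : Measurable fun t => ‖ρ t‖ₑ := hρ.measurable.enorm
  set ν : Measure E3 := volume.withDensity fun t => ‖ρ t‖ₑ with hν
  have hνp : IsProbabilityMeasure ν := ⟨by simp [hν, hρ1]⟩
  have hνac : ν ≪ volume := withDensity_absolutelyContinuous _ _
  have hshift (x : E3) : AEStronglyMeasurable (fun t => w (x - t)) volume :=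
    hw.comp_quasiMeasurePreserving (quasiMeasurePreserving_sub_left volume x)
  -- Jensen's inequality for the probability measure `|ρ(t)| dt`
  have hpt (x : E3) : ‖(ρ ⋆[ContinuousLinearMap.lsmul ℝ ℝ, volume] w) x‖ₑ ^ (2 : ℝ)
      ≤ ∫⁻ t, ‖ρ t‖ₑ * ‖w (x - t)‖ₑ ^ (2 : ℝ) := by
    have h1 : ‖(ρ ⋆[ContinuousLinearMap.lsmul ℝ ℝ, volume] w) x‖ₑ
        ≤ eLpNorm (fun t => w (x - t)) 1 ν := by
      rw [eLpNorm_one_eq_lintegral_enorm, hν, lintegral_withDensity_eq_lintegral_mul₀ hk.aemeasurable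
        (hshift x).enorm, convolution_def]
      refine (enorm_integral_le_lintegral_enorm _).trans (le_of_eq ?_)
      refine lintegral_congr fun t => ?_
      simp [enorm_mul]
    have h2 : eLpNorm (fun t => w (x - t)) 1 ν ≤ eLpNorm (fun t => w (x - t)) 2 ν :=
      eLpNorm_le_eLpNorm_of_exponent_le (by norm_num) ((hshift x).mono_ac hνac)
    have h3 : eLpNorm (fun t => w (x - t)) 2 ν ^ (2 : ℝ)
        = ∫⁻ t, ‖ρ t‖ₑ * ‖w (x - t)‖ₑ ^ (2 : ℝ) := by
      have := eLpNorm_nnreal_pow_eq_lintegral (f := fun t => w (x - t)) (μ := ν) (p := 2)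
        (by norm_num)
      simp only [NNReal.coe_ofNat, ENNReal.coe_ofNat] at this
      rw [this, hν, lintegral_withDensity_eq_lintegral_mul₀ hk.aemeasurable
        ((hshift x).enorm.pow_const _)]
      rfl
    rw [← h3]
    gcongr
    exact h1.trans h2
  have hsq (h : E3 → ℝ) : eLpNorm h 2 volume ^ (2 : ℝ) = ∫⁻ x, ‖h x‖ₑ ^ (2 : ℝ) := by
    have := eLpNorm_nnreal_pow_eq_lintegral (f := h) (μ := volume) (p := 2) (by norm_num)
    simpa only [NNReal.coe_ofNat, ENNReal.coe_ofNat] using this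
  rw [← ENNReal.rpow_le_rpow_iff (z := 2) (by norm_num), hsq, hsq]
  have hmeas : AEMeasurable (Function.uncurry fun x t => ‖ρ t‖ₑ * ‖w (x - t)‖ₑ ^ (2 : ℝ))
      ((volume : Measure E3).prod (volume : Measure E3)) := by
    refine (hk.comp measurable_snd).aemeasurable.mul (AEMeasurable.pow_const ?_ _)
    exact (hw.comp_quasiMeasurePreserving
      (quasiMeasurePreserving_sub_of_right_invariant volume volume)).enorm
  calc ∫⁻ x, ‖(ρ ⋆[ContinuousLinearMap.lsmul ℝ ℝ, volume] w) x‖ₑ ^ (2 : ℝ)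
      ≤ ∫⁻ x, ∫⁻ t, ‖ρ t‖ₑ * ‖w (x - t)‖ₑ ^ (2 : ℝ) := lintegral_mono hpt
    _ = ∫⁻ t, ∫⁻ x, ‖ρ t‖ₑ * ‖w (x - t)‖ₑ ^ (2 : ℝ) := lintegral_lintegral_swap hmeas
    _ = ∫⁻ t, ‖ρ t‖ₑ * ∫⁻ x, ‖w x‖ₑ ^ (2 : ℝ) := by
        refine lintegral_congr fun t => ?_
        rw [lintegral_const_mul' _ _ enorm_ne_top,
          lintegral_sub_right_eq_self (fun x => ‖w x‖ₑ ^ (2 : ℝ)) t]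
    _ = ∫⁻ x, ‖w x‖ₑ ^ (2 : ℝ) := by
        rw [lintegral_mul_const _ hk, hρ1, one_mul]

/-- Mollification commutes with the weak gradient. -/
theorem IsWeakGradient.fderiv_convolution {u : E3 → ℝ} {g : E3 → E3} (h : IsWeakGradient u g)
    {ρ : E3 → ℝ} (hρ : ContDiff ℝ ∞ ρ) (hρc : HasCompactSupport ρ) (x : E3) (i : Fin 3) :
    fderiv ℝ (ρ ⋆[ContinuousLinearMap.lsmul ℝ ℝ, volume] u) x (EuclideanSpace.single i (1 : ℝ))
      = (ρ ⋆[ContinuousLinearMap.lsmul ℝ ℝ, volume] fun y => g y i) x := by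
  have hu : LocallyIntegrable u volume := h.memLp_fun.locallyIntegrable (by norm_num)
  have hρ1 : ContDiff ℝ 1 ρ := hρ.of_le (by norm_num)
  set e : E3 := EuclideanSpace.single i (1 : ℝ)
  rw [(hρc.hasFDerivAt_convolution_left (ContinuousLinearMap.lsmul ℝ ℝ) hρ1 hu x).fderiv,
    convolution_eq_swap, convolution_eq_swap]
  have hex : ConvolutionExistsAt (fderiv ℝ ρ) u x
      ((ContinuousLinearMap.lsmul ℝ ℝ).precompL E3) volume :=
    (hρc.fderiv ℝ).convolutionExists_left _ (hρ1.continuous_fderiv (by norm_num)) hu x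
  rw [ContinuousLinearMap.integral_apply]
  swap
  · exact hex.integrable_swap
  -- the test function is the reflected kernel centred at `x`
  set ψ : E3 → ℝ := fun y => ρ (x - y) with hψ
  have hψd (y : E3) : fderiv ℝ ψ y e = - fderiv ℝ ρ (x - y) e := by
    have hd : HasFDerivAt ψ ((fderiv ℝ ρ (x - y)).comp (-ContinuousLinearMap.id ℝ E3)) y :=
      ((hρ1.differentiable (by norm_num)) (x - y)).hasFDerivAt.comp y
        ((hasFDerivAt_id y).const_sub x)
    rw [hd.fderiv]; simp
  have key := h.integral_eq ψ (hρ.comp (contDiff_const.sub contDiff_id))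
    (hρc.comp_homeomorph (Homeomorph.subLeft x)) i
  simp only [ContinuousLinearMap.precompL_apply, ContinuousLinearMap.lsmul_apply, smul_eq_mul]
  change ∫ y, u y * fderiv ℝ ψ y e = _ at key
  simp only [hψd, mul_neg, integral_neg, neg_inj] at key
  simpa only [hψ, mul_comm] using key

theorem norm_le_sum_norm_apply_single (L : E3 →L[ℝ] ℝ) :
    ‖L‖ ≤ ∑ i, ‖L (EuclideanSpace.single i (1 : ℝ))‖ := by
  refine L.opNorm_le_bound (by positivity) fun v => ?_
  have hv : v = ∑ i, v i • EuclideanSpace.single i (1 : ℝ) := by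
    ext j; simp [Finset.sum_apply, Pi.single_apply]
  calc ‖L v‖ = ‖∑ i, v i • L (EuclideanSpace.single i (1 : ℝ))‖ := by
        conv_lhs => rw [hv]
        simp only [map_sum, map_smul]
    _ ≤ ∑ i, ‖v i • L (EuclideanSpace.single i (1 : ℝ))‖ := norm_sum_le _ _
    _ ≤ ∑ i, ‖L (EuclideanSpace.single i (1 : ℝ))‖ * ‖v‖ := by
        refine Finset.sum_le_sum fun i _ => ?_
        rw [norm_smul, mul_comm]
        gcongr
        exact PiLp.norm_apply_le v i
    _ = _ := by rw [Finset.sum_mul]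

/-- Mollifying does not increase the `L²` norm of the gradient by more than a dimensional factor. -/
theorem IsWeakGradient.eLpNorm_fderiv_convolution_le {u : E3 → ℝ} {g : E3 → E3}
    (h : IsWeakGradient u g) {ρ : E3 → ℝ} (hρ : ContDiff ℝ ∞ ρ) (hρc : HasCompactSupport ρ)
    (hρ1 : ∫⁻ t, ‖ρ t‖ₑ = 1) :
    eLpNorm (fderiv ℝ (ρ ⋆[ContinuousLinearMap.lsmul ℝ ℝ, volume] u)) 2 volume
      ≤ 3 * eLpNorm g 2 volume := by
  have hgi (i : Fin 3) : MemLp (fun y => g y i) 2 volume :=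
    h.memLp_grad.eval_piLp i
  set c : Fin 3 → E3 → ℝ := fun i => ρ ⋆[ContinuousLinearMap.lsmul ℝ ℝ, volume] fun y => g y i
  have hc (i : Fin 3) : Continuous (c i) :=
    hρc.continuous_convolution_left _ hρ.continuous ((hgi i).locallyIntegrable (by norm_num))
  calc eLpNorm (fderiv ℝ (ρ ⋆[ContinuousLinearMap.lsmul ℝ ℝ, volume] u)) 2 volume
      ≤ eLpNorm (∑ i, fun x => ‖c i x‖) 2 volume := by
        refine eLpNorm_mono_real fun x => ?_
        refine (norm_le_sum_norm_apply_single _).trans (le_of_eq ?_)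
        rw [Finset.sum_apply]
        exact Finset.sum_congr rfl fun i _ => by rw [h.fderiv_convolution hρ hρc]
    _ ≤ ∑ i, eLpNorm (fun x => ‖c i x‖) 2 volume :=
        eLpNorm_sum_le (fun i _ => (hc i).norm.aestronglyMeasurable) (by norm_num)
    _ ≤ ∑ i : Fin 3, eLpNorm g 2 volume := by
        refine Finset.sum_le_sum fun i _ => ?_
        rw [eLpNorm_norm]
        refine (eLpNorm_convolution_le hρ.continuous hρ1 (hgi i).aestronglyMeasurable).trans ?_
        exact eLpNorm_mono fun x => PiLp.norm_apply_le (g x) i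
    _ = 3 * eLpNorm g 2 volume := by simp

/-- Smooth compactly supported functions which equal one on growing balls and have uniformly
bounded gradients. -/
theorem exists_cutoff : ∃ K : ℝ≥0, ∃ χ : ℕ → E3 → ℝ, (∀ n, ContDiff ℝ ∞ (χ n)) ∧
    (∀ n, HasCompactSupport (χ n)) ∧ (∀ n x, ‖χ n x‖ ≤ 1) ∧ (∀ n x, ‖fderiv ℝ (χ n) x‖ ≤ K) ∧
    ∀ x, Tendsto (fun n => χ n x) atTop (𝓝 1) := by
  let b : ContDiffBump (0 : E3) := ⟨1, 2, one_pos, one_lt_two⟩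
  have hb : ContDiff ℝ ∞ b := b.contDiff
  obtain ⟨K, hK⟩ := (b.hasCompactSupport.fderiv ℝ).exists_bound_of_continuous
    (hb.continuous_fderiv (by simp))
  have hpos (n : ℕ) : (0 : ℝ) < ((n : ℝ) + 1)⁻¹ := by positivity
  refine ⟨K.toNNReal, fun n x => b (((n : ℝ) + 1)⁻¹ • x), fun n => ?_, fun n => ?_, fun n x => ?_,
    fun n x => ?_, fun x => ?_⟩
  · exact hb.comp (contDiff_const_smul _)
  · exact b.hasCompactSupport.comp_smul (hpos n).ne'
  · rw [Real.norm_of_nonneg b.nonneg]; exact b.le_one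
  · rw [fderiv_comp_smul]
    rw [norm_smul, Real.norm_of_nonneg (hpos n).le]
    have h1 : ((n : ℝ) + 1)⁻¹ ≤ 1 := inv_le_one_of_one_le₀ (by linarith [n.cast_nonneg (α := ℝ)])
    exact (mul_le_of_le_one_left (norm_nonneg _) h1).trans
      ((hK _).trans (Real.le_coe_toNNReal K))
  · have h0 : Tendsto (fun n : ℕ => ((n : ℝ) + 1)⁻¹ • x) atTop (𝓝 0) := by
      have := (tendsto_one_div_add_atTop_nhds_zero_nat (𝕜 := ℝ)).smul_const x
      simpa only [one_div, zero_smul] using this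
    refine tendsto_const_nhds.congr' ?_
    filter_upwards [h0.eventually (Metric.closedBall_mem_nhds (0 : E3) one_pos)] with n hn
    exact (b.one_of_mem_closedBall hn).symm

/-- The **Sobolev inequality** `‖u‖₆ ≤ C (‖∇u‖₂ + ‖u‖₂)` in `H¹(ℝ³)`. -/
theorem exists_eLpNorm_six_le : ∃ C : ℝ≥0, ∀ (u : E3 → ℝ) (g : E3 → E3), IsWeakGradient u g →
    eLpNorm u 6 volume ≤ C * (eLpNorm g 2 volume + eLpNorm u 2 volume) := by
  obtain ⟨K, χ, hχ, hχc, hχ1, hχK, hχt⟩ := exists_cutoff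
  set S := eLpNormLESNormFDerivOfEqInnerConst (volume : Measure E3) ((2 : ℝ≥0) : ℝ)
  refine ⟨S * (3 + K), fun u g h => ?_⟩
  have hu : LocallyIntegrable u volume := h.memLp_fun.locallyIntegrable (by norm_num)
  -- an approximate identity with radii in a fixed ratio, so that mollification converges a.e.
  let φ : ℕ → ContDiffBump (0 : E3) := fun n =>
    ⟨((n : ℝ) + 1)⁻¹, 2 * ((n : ℝ) + 1)⁻¹, by positivity,
      lt_mul_of_one_lt_left (by positivity) one_lt_two⟩
  set ρ : ℕ → E3 → ℝ := fun n => (φ n).normed volume with hρdef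
  have hρ (n : ℕ) : ContDiff ℝ ∞ (ρ n) := (φ n).contDiff_normed
  have hρc (n : ℕ) : HasCompactSupport (ρ n) := (φ n).hasCompactSupport_normed
  have hρ1 (n : ℕ) : ∫⁻ t, ‖ρ n t‖ₑ = 1 := by
    have h1 : ∫⁻ t, ‖ρ n t‖ₑ = ENNReal.ofReal (∫ t, ρ n t) := by
      rw [ofReal_integral_eq_lintegral_ofReal (φ n).integrable_normed
        (ae_of_all _ fun t => (φ n).nonneg_normed t)]
      exact lintegral_congr fun t => Real.enorm_of_nonneg ((φ n).nonneg_normed t)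
    rw [h1, (φ n).integral_normed, ENNReal.ofReal_one]
  set w : ℕ → E3 → ℝ := fun n => ρ n ⋆[ContinuousLinearMap.lsmul ℝ ℝ, volume] u with hw
  have hwc (n : ℕ) : ContDiff ℝ ∞ (w n) := (hρc n).contDiff_convolution_left _ (hρ n) hu
  have hwt : ∀ᵐ x, Tendsto (fun n => w n x) atTop (𝓝 (u x)) := by
    refine ContDiffBump.ae_convolution_tendsto_right_of_locallyIntegrable (K := 2) ?_ ?_ hu
    · have := (tendsto_one_div_add_atTop_nhds_zero_nat (𝕜 := ℝ)).const_mul 2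
      simpa only [one_div, mul_zero] using this
    · exact Eventually.of_forall fun n => le_rfl
  have hbound (n : ℕ) : eLpNorm (χ n * w n) 6 volume
      ≤ ((S * (3 + K) : ℝ≥0) : ℝ≥0∞) * (eLpNorm g 2 volume + eLpNorm u 2 volume) := by
    have hd : eLpNorm (fderiv ℝ (χ n * w n)) 2 volume
        ≤ 3 * eLpNorm g 2 volume + K * eLpNorm u 2 volume := by
      have hle (x : E3) : ‖fderiv ℝ (χ n * w n) x‖
          ≤ ‖fderiv ℝ (w n) x‖ + K * ‖w n x‖ := by
        rw [fderiv_mul ((hχ n).differentiable (by simp) x) ((hwc n).differentiable (by simp) x)]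
        refine (norm_add_le _ _).trans ?_
        rw [norm_smul, norm_smul, mul_comm (‖w n x‖)]
        gcongr
        · exact mul_le_of_le_one_left (norm_nonneg _) (hχ1 n x)
        · exact hχK n x
      calc eLpNorm (fderiv ℝ (χ n * w n)) 2 volume
          ≤ eLpNorm ((fun x => ‖fderiv ℝ (w n) x‖) + fun x => K * ‖w n x‖) 2 volume :=
            eLpNorm_mono_real hle
        _ ≤ eLpNorm (fun x => ‖fderiv ℝ (w n) x‖) 2 volume
            + eLpNorm (fun x => K * ‖w n x‖) 2 volume :=
            eLpNorm_add_le
              ((hwc n).continuous_fderiv (by simp)).norm.aestronglyMeasurable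
              ((hwc n).continuous.norm.const_mul _).aestronglyMeasurable (by norm_num)
        _ ≤ 3 * eLpNorm g 2 volume + K * eLpNorm u 2 volume := by
            rw [eLpNorm_norm]
            refine add_le_add (h.eLpNorm_fderiv_convolution_le (hρ n) (hρc n) (hρ1 n)) ?_
            have := eLpNorm_le_mul_eLpNorm_of_ae_le_mul (μ := volume)
              (f := fun x => (K : ℝ) * ‖w n x‖) (g := w n) (c := K)
              (ae_of_all _ fun x => by simp) 2
            refine this.trans ?_
            rw [ENNReal.ofReal_coe_nnreal]
            gcongr
            exact eLpNorm_convolution_le (hρ n).continuous (hρ1 n) h.memLp_fun.1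
    have hS := eLpNorm_le_eLpNorm_fderiv_of_eq_inner (volume : Measure E3) (u := χ n * w n)
      (p := 2) (p' := 6) (((hχ n).mul (hwc n)).of_le (by norm_num)) ((hχc n).mul_right)
      (by norm_num) (by simp) (by simp; norm_num)
    simp only [ENNReal.coe_ofNat] at hS
    calc eLpNorm (χ n * w n) 6 volume ≤ S * eLpNorm (fderiv ℝ (χ n * w n)) 2 volume := hS
      _ ≤ S * ((3 + K) * eLpNorm g 2 volume + (3 + K) * eLpNorm u 2 volume) := by
          gcongr
          refine hd.trans ?_
          gcongr
          · exact le_self_add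
          · exact le_add_self
      _ = _ := by push_cast; ring
  refine Lp.eLpNorm_le_of_ae_tendsto (u := atTop) (f := fun n => χ n * w n)
    (Eventually.of_forall hbound)
    (fun n => ((hχ n).continuous.mul (hwc n).continuous).aestronglyMeasurable) ?_
  filter_upwards [hwt] with x hx
  simpa using (hχt x).mul hx

/-- The Sobolev inequality in terms of real integrals. -/
theorem exists_integral_pow_six_le : ∃ C : ℝ, 0 < C ∧ ∀ (u : E3 → ℝ) (g : E3 → E3),
    IsWeakGradient u g → Integrable (fun x => u x ^ 6) ∧
      ∫ x, u x ^ 6 ≤ C * (∫ x, (‖g x‖ ^ 2 + u x ^ 2)) ^ 3 := by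
  obtain ⟨C, hC⟩ := exists_eLpNorm_six_le
  -- the summand `1` only makes the constant positive
  refine ⟨(2 * C) ^ 6 + 1, by positivity, fun u g h => ?_⟩
  have hle := hC u g h
  have hg2 : Integrable fun x => ‖g x‖ ^ 2 := h.memLp_grad.norm.integrable_sq
  have hu2 : Integrable fun x => u x ^ 2 := h.memLp_fun.integrable_sq
  have hu6 : MemLp u 6 volume := ⟨h.memLp_fun.1, hle.trans_lt
    (ENNReal.mul_lt_top ENNReal.coe_lt_top (ENNReal.add_lt_top.2 ⟨h.memLp_grad.2, h.memLp_fun.2⟩))⟩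
  have hi6 : Integrable fun x => u x ^ 6 := by
    have := hu6.integrable_norm_pow (p := 6) (by norm_num)
    refine this.congr (ae_of_all _ fun x => ?_)
    simp [Even.pow_abs (by decide : Even 6)]
  refine ⟨hi6, ?_⟩
  set A := ∫ x, ‖g x‖ ^ 2
  set B := ∫ x, u x ^ 2
  set D := ∫ x, u x ^ 6
  have hA : 0 ≤ A := integral_nonneg fun x => by positivity
  have hB : 0 ≤ B := integral_nonneg fun x => by positivity
  have hD : 0 ≤ D := integral_nonneg fun x => by positivity
  have eg : eLpNorm g 2 volume = ENNReal.ofReal (A ^ (2 : ℝ)⁻¹) := by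
    rw [h.memLp_grad.eLpNorm_eq_integral_rpow_norm (by norm_num) (by norm_num)]
    simp [A]
  have eu : eLpNorm u 2 volume = ENNReal.ofReal (B ^ (2 : ℝ)⁻¹) := by
    rw [h.memLp_fun.eLpNorm_eq_integral_rpow_norm (by norm_num) (by norm_num)]
    simp [B]
  have e6 : eLpNorm u 6 volume = ENNReal.ofReal (D ^ (6 : ℝ)⁻¹) := by
    rw [hu6.eLpNorm_eq_integral_rpow_norm (by norm_num) (by norm_num)]
    have (x : E3) : |u x| ^ (6 : ℝ) = u x ^ 6 := by
      rw [show (6 : ℝ) = ((6 : ℕ) : ℝ) by norm_num, Real.rpow_natCast,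
        Even.pow_abs (by decide : Even 6)]
    simp [D, this]
  rw [integral_add hg2 hu2]
  have hE : 0 ≤ A + B := by positivity
  have hreal : D ^ (6 : ℝ)⁻¹ ≤ 2 * C * (A + B) ^ (2 : ℝ)⁻¹ := by
    rw [eg, eu, e6, ← ENNReal.ofReal_add (by positivity) (by positivity),
      ← ENNReal.ofReal_coe_nnreal, ← ENNReal.ofReal_mul (by positivity),
      ENNReal.ofReal_le_ofReal_iff (by positivity)] at hle
    have h1 : A ^ (2 : ℝ)⁻¹ ≤ (A + B) ^ (2 : ℝ)⁻¹ := by gcongr; linarith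
    have h2 : B ^ (2 : ℝ)⁻¹ ≤ (A + B) ^ (2 : ℝ)⁻¹ := by gcongr; linarith
    nlinarith [C.coe_nonneg]
  calc D = (D ^ (6 : ℝ)⁻¹) ^ 6 := by
        rw [← Real.rpow_natCast, ← Real.rpow_mul hD]; norm_num
    _ ≤ (2 * C * (A + B) ^ (2 : ℝ)⁻¹) ^ 6 := by gcongr
    _ = (2 * C) ^ 6 * (A + B) ^ 3 := by
        rw [mul_pow, ← Real.rpow_natCast ((A + B) ^ (2 : ℝ)⁻¹), ← Real.rpow_mul hE,
          ← Real.rpow_natCast (A + B) 3]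
        norm_num
    _ ≤ ((2 * C) ^ 6 + 1) * (A + B) ^ 3 := by gcongr; linarith

/-! ### The nonlinearity and its primitive -/

section Nonlinearity

variable {f : ℝ → ℝ}

theorem even_mul_self_of_odd (f2 : ∀ t : ℝ, f t = - f (-t)) (t : ℝ) :
    f (-t) * (-t) = f t * t := by
  rw [f2 t]; ring

theorem primitive_neg (f2 : ∀ t : ℝ, f t = - f (-t)) (t : ℝ) :
    primitive f (-t) = primitive f t := by
  have h := intervalIntegral.integral_comp_neg (a := 0) (b := t) f
  rw [neg_zero, intervalIntegral.integral_symm 0 (-t)] at h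
  have h2 : ∫ x in (0 : ℝ)..t, f (-x) = - ∫ x in (0 : ℝ)..t, f x := by
    rw [← intervalIntegral.integral_neg]
    exact intervalIntegral.integral_congr fun x _ => by simp [f2 x]
  unfold primitive
  linarith

theorem mul_self_le_pow_four (f4_lt : ∀ t : ℝ, t ≠ 0 → f t / t ^ 3 < 1) (t : ℝ) :
    f t * t ≤ t ^ 4 := by
  rcases eq_or_ne t 0 with rfl | ht
  · simp
  · have h4 : 0 ≤ t ^ 4 := by positivity
    have h := mul_le_mul_of_nonneg_right (f4_lt t ht).le h4
    have e : f t / t ^ 3 * t ^ 4 = f t * t := by field_simp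
    linarith

/-- Monotonicity of `f(t)/t³` gives `4F(t) ≤ f(t)t`. -/
theorem four_mul_primitive_le (f1 : Continuous f) (f2 : ∀ t : ℝ, f t = - f (-t))
    (f5 : StrictMonoOn (fun t : ℝ => f t / t ^ 3) (Set.Ioi 0)) (t : ℝ) :
    4 * primitive f t ≤ f t * t := by
  have hf0 : f 0 = 0 := by have := f2 0; rw [neg_zero] at this; linarith
  have hpos : ∀ s : ℝ, 0 < s → 4 * primitive f s ≤ f s * s := by
    intro s hs
    have hmono : primitive f s ≤ ∫ τ in (0 : ℝ)..s, f s / s ^ 3 * τ ^ 3 := by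
      refine intervalIntegral.integral_mono_on hs.le (f1.intervalIntegrable _ _)
        (Continuous.intervalIntegrable (by fun_prop) _ _) fun τ hτ => ?_
      rcases hτ.1.eq_or_lt with h0 | h0
      · simp [← h0, hf0]
      · have := f5.monotoneOn (Set.mem_Ioi.2 h0) (Set.mem_Ioi.2 hs) hτ.2
        exact (div_le_iff₀ (by positivity)).1 this
    rw [intervalIntegral.integral_const_mul, integral_pow] at hmono
    have e : f s / s ^ 3 * ((s ^ (3 + 1) - 0 ^ (3 + 1)) / ((3 : ℕ) + 1)) = f s * s / 4 := by
      field_simp; norm_num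
    rw [e] at hmono
    linarith
  rcases lt_trichotomy t 0 with ht | rfl | ht
  · have := hpos (-t) (by linarith)
    rwa [primitive_neg f2, even_mul_self_of_odd f2] at this
  · simp [primitive]
  · exact hpos t ht

/-- Near zero the growth bound is `f(t) = o(t)`; away from zero, `f(t)/t³` lies between its value
at a fixed point and `1`. -/
theorem exists_abs_le (f2 : ∀ t : ℝ, f t = - f (-t))
    (f3 : Tendsto (fun t : ℝ => f t / t) (𝓝[≠] 0) (𝓝 0))
    (f4_lt : ∀ t : ℝ, t ≠ 0 → f t / t ^ 3 < 1)
    (f5 : StrictMonoOn (fun t : ℝ => f t / t ^ 3) (Set.Ioi 0)) :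
    ∃ C : ℝ, 0 ≤ C ∧ ∀ t, |f t| ≤ |t| + C * |t| ^ 3 := by
  have hf0 : f 0 = 0 := by have := f2 0; rw [neg_zero] at this; linarith
  obtain ⟨δ, hδ, hδf⟩ : ∃ δ > 0, ∀ t : ℝ, t ≠ 0 → |t| < δ → |f t / t| < 1 := by
    have := f3.eventually (Metric.ball_mem_nhds (0 : ℝ) one_pos)
    rw [eventually_nhdsWithin_iff, Metric.eventually_nhds_iff] at this
    obtain ⟨δ, hδ, h⟩ := this
    refine ⟨δ, hδ, fun t ht htδ => ?_⟩
    simpa [abs_div] using h (y := t) (by simpa using htδ) ht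
  set C : ℝ := 1 + |f δ / δ ^ 3|
  have hC : 0 ≤ C := by positivity
  have hpos : ∀ t : ℝ, 0 < t → |f t| ≤ |t| + C * |t| ^ 3 := by
    intro t ht
    rw [abs_of_pos ht]
    rcases lt_or_ge t δ with h | h
    · have := hδf t ht.ne' (by rwa [abs_of_pos ht])
      rw [abs_div, abs_of_pos ht, div_lt_one ht] at this
      have : 0 ≤ C * t ^ 3 := by positivity
      linarith
    · have h1 : f δ / δ ^ 3 ≤ f t / t ^ 3 := f5.monotoneOn (Set.mem_Ioi.2 hδ) (Set.mem_Ioi.2 ht) h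
      have h2 : |f t / t ^ 3| ≤ C := by
        have h3 := neg_abs_le (f δ / δ ^ 3)
        have h4 := f4_lt t ht.ne'
        have h5 := abs_nonneg (f δ / δ ^ 3)
        exact abs_le.2 ⟨by simp only [C]; linarith, by simp only [C]; linarith⟩
      have h3 : 0 < t ^ 3 := by positivity
      rw [abs_div, abs_of_pos h3, div_le_iff₀ h3] at h2
      linarith
  refine ⟨C, hC, fun t => ?_⟩
  rcases lt_trichotomy t 0 with ht | rfl | ht
  · have := hpos (-t) (by linarith)
    rwa [abs_neg, ← abs_neg (f (-t)), ← f2 t] at this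
  · simp [hf0]
  · exact hpos t ht

theorem abs_primitive_le {C : ℝ} (hC : 0 ≤ C) (h : ∀ t, |f t| ≤ |t| + C * |t| ^ 3) (t : ℝ) :
    |primitive f t| ≤ t ^ 2 + C * t ^ 4 := by
  have h1 : ∀ x ∈ Set.uIoc (0 : ℝ) t, ‖f x‖ ≤ |t| + C * |t| ^ 3 := by
    intro x hx
    have hxt : |x| ≤ |t| := by
      have := Set.abs_sub_left_of_mem_uIcc (Set.uIoc_subset_uIcc hx)
      simpa using this
    refine (h x).trans ?_
    gcongr
  have h2 := intervalIntegral.norm_integral_le_of_norm_le_const h1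
  rw [sub_zero] at h2
  calc |primitive f t| ≤ (|t| + C * |t| ^ 3) * |t| := h2
    _ = |t| ^ 2 + C * |t| ^ 4 := by ring
    _ = t ^ 2 + C * t ^ 4 := by rw [sq_abs, Even.pow_abs (by decide : Even 4)]

theorem continuous_primitive (f1 : Continuous f) : Continuous (primitive f) :=
  intervalIntegral.continuous_primitive (fun _ _ => f1.intervalIntegrable _ _) 0

end Nonlinearity

theorem potential_nonneg (u : E3 → ℝ) (x : E3) : 0 ≤ potential u x :=
  integral_nonneg fun y => by positivity

theorem isWeakGradient_weakGrad {u : E3 → ℝ} (h : MemH1 u) : IsWeakGradient u (weakGrad u) := by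
  rw [weakGrad, dif_pos h]
  exact h.choose_spec

/-! ### The energy on the Nehari set -/

section Nehari

variable {f : ℝ → ℝ} {lam : ℝ} {u : E3 → ℝ}

theorem integrable_nonlinearity_mul_self {C : ℝ} (f1 : Continuous f)
    (hf : ∀ t, |f t| ≤ |t| + C * |t| ^ 3) (hu2 : MemLp u 2 volume)
    (hu4 : Integrable fun x => u x ^ 4) : Integrable fun x => f (u x) * u x := by
  have hdom : Integrable fun x => u x ^ 2 + C * u x ^ 4 := hu2.integrable_sq.add (hu4.const_mul C)
  refine hdom.mono' ((f1.comp_aestronglyMeasurable hu2.1).mul hu2.1) (ae_of_all _ fun x => ?_)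
  rw [Real.norm_eq_abs, abs_mul]
  calc |f (u x)| * |u x| ≤ (|u x| + C * |u x| ^ 3) * |u x| := by gcongr; exact hf _
    _ = |u x| ^ 2 + C * |u x| ^ 4 := by ring
    _ = u x ^ 2 + C * u x ^ 4 := by rw [sq_abs, Even.pow_abs (by decide : Even 4)]

theorem integrable_primitive {C : ℝ} (hC : 0 ≤ C) (f1 : Continuous f)
    (hf : ∀ t, |f t| ≤ |t| + C * |t| ^ 3) (hu2 : MemLp u 2 volume)
    (hu4 : Integrable fun x => u x ^ 4) : Integrable fun x => primitive f (u x) :=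
  (hu2.integrable_sq.add (hu4.const_mul C)).mono'
    ((continuous_primitive f1).comp_aestronglyMeasurable hu2.1)
    (ae_of_all _ fun _ => abs_primitive_le hC hf _)

theorem dEnergy_self (f : ℝ → ℝ) (lam : ℝ) (u : E3 → ℝ) :
    dEnergy f lam u u = (∫ x, (‖weakGrad u x‖ ^ 2 + u x ^ 2))
      + lam * (∫ x, potential u x * u x ^ 2) - ∫ x, f (u x) * u x := by
  simp only [dEnergy, real_inner_self_eq_norm_sq, pow_two, mul_assoc]

/-- On the Nehari set the energy controls the squared `H¹` norm, because
`I(u) = I(u) - I'(u)[u] / 4 = ‖u‖² / 4 + ∫ (f(u)u / 4 - F(u))`. -/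
theorem quarter_norm_sq_le_energy (f1 : Continuous f) (f2 : ∀ t : ℝ, f t = - f (-t))
    (f5 : StrictMonoOn (fun t : ℝ => f t / t ^ 3) (Set.Ioi 0))
    (hfu : Integrable fun x => f (u x) * u x) (hFu : Integrable fun x => primitive f (u x))
    (hN : dEnergy f lam u u = 0) :
    1 / 4 * ∫ x, (‖weakGrad u x‖ ^ 2 + u x ^ 2) ≤ energy f lam u := by
  have hF : 4 * ∫ x, primitive f (u x) ≤ ∫ x, f (u x) * u x := by
    rw [← integral_const_mul]
    exact integral_mono (hFu.const_mul 4) hfu fun x => four_mul_primitive_le f1 f2 f5 _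
  rw [dEnergy_self] at hN
  unfold energy
  linarith

/-- The Nehari identity bounds the squared `H¹` norm by `∫ u⁴`, since the Poisson term is
nonnegative and `f(t)t ≤ t⁴`. -/
theorem norm_sq_le_integral_pow_four (hlam : 0 < lam)
    (f4_lt : ∀ t : ℝ, t ≠ 0 → f t / t ^ 3 < 1)
    (hfu : Integrable fun x => f (u x) * u x) (hu4 : Integrable fun x => u x ^ 4)
    (hN : dEnergy f lam u u = 0) :
    ∫ x, (‖weakGrad u x‖ ^ 2 + u x ^ 2) ≤ ∫ x, u x ^ 4 := by
  have hle : ∫ x, f (u x) * u x ≤ ∫ x, u x ^ 4 :=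
    integral_mono hfu hu4 fun x => mul_self_le_pow_four f4_lt _
  have hP : 0 ≤ lam * ∫ x, potential u x * u x ^ 2 :=
    mul_nonneg hlam.le (integral_nonneg fun x => mul_nonneg (potential_nonneg u x) (sq_nonneg _))
  rw [dEnergy_self] at hN
  linarith

/-- The squared `H¹` norm `E` of a Nehari function satisfies `E ≤ ∫ u⁴ ≤ (E + ∫ u⁶) / 2`, hence
`E ≤ C E³` by the Sobolev inequality; this keeps the energy away from zero. -/
theorem exists_pos_le_energy (hlam : 0 < lam) (f1 : Continuous f) (f2 : ∀ t : ℝ, f t = - f (-t))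
    (f3 : Tendsto (fun t : ℝ => f t / t) (𝓝[≠] 0) (𝓝 0))
    (f4_lt : ∀ t : ℝ, t ≠ 0 → f t / t ^ 3 < 1)
    (f5 : StrictMonoOn (fun t : ℝ => f t / t ^ 3) (Set.Ioi 0)) :
    ∃ c : ℝ, 0 < c ∧ ∀ u ∈ nehari f lam, c ≤ energy f lam u := by
  obtain ⟨K, hK, hf⟩ := exists_abs_le f2 f3 f4_lt f5
  obtain ⟨C, hC, hS⟩ := exists_integral_pow_six_le
  refine ⟨1 / 4 * (1 / (1 + C)), by positivity, fun u hu => ?_⟩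
  obtain ⟨⟨hH1, -⟩, hu0, hN⟩ := hu
  have hw := isWeakGradient_weakGrad hH1
  obtain ⟨hu6, hS6⟩ := hS u _ hw
  have hu2 : Integrable fun x => u x ^ 2 := hw.memLp_fun.integrable_sq
  have hg2 : Integrable fun x => ‖weakGrad u x‖ ^ 2 := hw.memLp_grad.norm.integrable_sq
  have hyoung (t : ℝ) : t ^ 4 ≤ 1 / 2 * (t ^ 2 + t ^ 6) := by
    nlinarith [mul_nonneg (sq_nonneg t) (sq_nonneg (t ^ 2 - 1))]
  have hu4 : Integrable fun x => u x ^ 4 := by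
    refine ((hu2.add hu6).const_mul (1 / 2)).mono' (hw.memLp_fun.1.pow 4) (ae_of_all _ fun x => ?_)
    rw [Real.norm_of_nonneg (by positivity)]
    exact hyoung _
  have hfu := integrable_nonlinearity_mul_self f1 hf hw.memLp_fun hu4
  have hFu := integrable_primitive hK f1 hf hw.memLp_fun hu4
  have hen := quarter_norm_sq_le_energy f1 f2 f5 hfu hFu hN
  have hE4 := norm_sq_le_integral_pow_four hlam f4_lt hfu hu4 hN
  have h46 : ∫ x, u x ^ 4 ≤ 1 / 2 * ((∫ x, u x ^ 2) + ∫ x, u x ^ 6) := by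
    rw [← integral_add hu2 hu6, ← integral_const_mul]
    exact integral_mono hu4 ((hu2.add hu6).const_mul (1 / 2)) fun x => hyoung _
  have hB : 0 < ∫ x, u x ^ 2 := by
    refine (integral_nonneg fun x => sq_nonneg (u x)).lt_of_ne' fun h => hu0 ?_
    filter_upwards [(integral_eq_zero_iff_of_nonneg (fun x => sq_nonneg (u x)) hu2).1 h] with x hx
    exact pow_eq_zero_iff (two_ne_zero) |>.1 hx
  have hBE : ∫ x, u x ^ 2 ≤ ∫ x, (‖weakGrad u x‖ ^ 2 + u x ^ 2) :=
    integral_mono hu2 (hg2.add hu2) fun x => le_add_of_nonneg_left (sq_nonneg _)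
  set E := ∫ x, (‖weakGrad u x‖ ^ 2 + u x ^ 2)
  have hE : 0 < E := hB.trans_le hBE
  have hcub : E * 1 ≤ E * (C * E ^ 2) := by nlinarith
  have h1 : 1 ≤ C * E ^ 2 := le_of_mul_le_mul_left hcub hE
  have hlow : 1 / (1 + C) ≤ E := by
    by_contra! h
    rw [lt_div_iff₀ (by positivity)] at h
    have hCE : 0 < C * E := by positivity
    nlinarith
  linarith

end Nehari

end SchrodingerPoisson

end

/-- For `λ > 0` and an asymptotically cubic nonlinearity `f` as below, `c = inf_𝓜 I > 0`. The infimum is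
taken in the extended reals, so that its positivity includes that `I` is bounded below on `𝓜`. -/
theorem corollary3p5 (f : ℝ → ℝ) (lam : ℝ) (hlam : 0 < lam)
    (f1 : Continuous f)
    (f2 : ∀ t : ℝ, f t = - f (-t))
    (f3 : Tendsto (fun t : ℝ => f t / t) (𝓝[≠] 0) (𝓝 0))
    (f4_lim : Tendsto (fun t : ℝ => f t / t ^ 3) atTop (𝓝 1))
    (f4_lt : ∀ t : ℝ, t ≠ 0 → f t / t ^ 3 < 1)
    (f5 : StrictMonoOn (fun t : ℝ => f t / t ^ 3) (Set.Ioi 0))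
    (f6 : Tendsto (fun t : ℝ => f t * t - 4 * SchrodingerPoisson.primitive f t) atTop atTop) :
    (0 : EReal) < ⨅ u ∈ SchrodingerPoisson.nodalNehari f lam,
      ((SchrodingerPoisson.energy f lam u : ℝ) : EReal) := by
  obtain ⟨c, hc, h⟩ := SchrodingerPoisson.exists_pos_le_energy hlam f1 f2 f3 f4_lt f5
  exact (EReal.coe_pos.2 hc).trans_le
    (le_iInf₂ fun u hu => EReal.coe_le_coe_iff.2 (h u hu.1))
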